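/- Let $M\ge 1$, $K\ge 2$, $d\ge 0$ be integers, let $0<a_1\le\dots\le a_K$ be weights and $\lambda_1\le\dots\le\lambda_M$ real numbers with (i) $d\sum_{n=1}^K a_n^2=\sum_{m=1}^M\lambda_m$, (ii) $a_{K-1}^2+a_K^2\le\lambda_1$, (iii) $\sum_{n=1}^K a_n^2\ge 2\lambda_M$. Then STC/STR (the spectral tetris construction with re-ordering), run on the eigenvalues $\lambda_1,\dots,\lambda_M$ and on the sequence of $N=dK$ norms $a_1,\dots,a_K,a_1,\dots,a_K,\dots,a_1,\dots,a_K$ ($d$ rounds), completes its $M\times N$ synthesis matrix and constructs a weighted fusion frame $\{W_k,a_k\}_{k=1}^K$ for $\mathbb R^M$ with $\dim W_k=d$ for every $k$, whose fusion frame operator $\sum_k a_k^2P_k$ ($P_k$ the orthogonal projection onto $W_k$) has spectrum $\lambda_1,\dots,\lambda_M$, counted with multiplicity. In detail: the columns $f_1,\dots,f_N$ of the matrix have as norms the final ordering of the given norms; if $J_k$ is the set of the columns whose norm is a copy of $a_k$ (copies of different $a_k$'s being kept apart even when the values coincide), then $W_k=\operatorname{span}\{f_n:n\in J_k\}$, the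 family $\{f_n\}_{n\in J_k}$ is a tight frame for $W_k$ with bound $a_k^2$, and the frame operator $\sum_n\langle\cdot,f_n\rangle f_n$ equals $\sum_k a_k^2P_k$. Here STC/STR is the following algorithm for norms $b_1,\dots,b_N$ and eigenvalues $\lambda_1,\dots,\lambda_M$, with $e_1,\dots,e_M$ the standard basis of $\mathbb R^M$. Start with $n=1$. For $m=1,\dots,M$ repeat the following until $\lambda_m=0$. - If $\lambda_m\ge b_n^2$: set $f_n=b_ne_m$, replace $\lambda_m$ by $\lambda_m-b_n^2$ and $n$ by $n+1$. - If $\lambda_m<b_n^2$ and $\lambda_m>b_{n+1}^2$: interchange $b_n$ and $b_{n+1}$, then proceed as in the first case (with the new $b_n$). - If $\lambda_m<b_n^2$ and $\lambda_m\le b_{n+1}^2$: put $x=\lambda_m$, $y=b_n^2+b_{n+1}^2-x$ and $$f_n=\sqrt{\tfrac{x(b_n^2-y)}{x-y}}\,e_m+\sqrt{\tfrac{y(x-b_n^2)}{x-y}}\,e_{m+1},\qquad f_{n+1}=\sqrt{\tfrac{x(x-b_n^2)}{x-y}}\,e_m-\sqrt{\tfrac{y(b_n^2-y)}{x-y}}\,e_{m+1}$$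 (if $x=y$, then $f_n=\sqrt{x/2}\,(e_m+e_{m+1})$ and $f_{n+1}=\sqrt{x/2}\,(e_m-e_{m+1})$); replace $\lambda_{m+1}$ by $\lambda_{m+1}-y$, $\lambda_m$ by $0$ and $n$ by $n+2$. -/

import Mathlib

namespace SpectralTetris

noncomputable section

/-! ## Frames and fusion frames in `ℝ^M` -/

/-- The family `(f n)` with `n ∈ J` is a tight frame for the subspace `W` with frame bound `A`. -/
def IsTightFrameOn {M N : ℕ} (f : Fin N → EuclideanSpace ℝ (Fin M)) (J : Finset (Fin N))
    (W : Submodule ℝ (EuclideanSpace ℝ (Fin M))) (A : ℝ) : Prop :=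
  0 < A ∧ (∀ n ∈ J, f n ∈ W) ∧ ∀ v ∈ W, ∑ n ∈ J, (inner ℝ v (f n)) ^ 2 = A * ‖v‖ ^ 2

/-- The frame operator `v ↦ ∑ n, ⟪v, f n⟫ f n` of a finite family of vectors. -/
def frameOp {M N : ℕ} (f : Fin N → EuclideanSpace ℝ (Fin M)) :
    EuclideanSpace ℝ (Fin M) →L[ℝ] EuclideanSpace ℝ (Fin M) :=
  ∑ n, (innerSL ℝ (f n)).smulRight (f n)

/-- `(W k, ν k)` is a fusion frame for `ℝ^M`. -/
def IsFusionFrame {M K : ℕ} (W : Fin K → Submodule ℝ (EuclideanSpace ℝ (Fin M)))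
    (ν : Fin K → ℝ) : Prop :=
  (∀ k, 0 < ν k) ∧ ∃ A B : ℝ, 0 < A ∧ A ≤ B ∧ ∀ v : EuclideanSpace ℝ (Fin M),
    A * ‖v‖ ^ 2 ≤ ∑ k, ν k ^ 2 * ‖(W k).starProjection v‖ ^ 2 ∧
    ∑ k, ν k ^ 2 * ‖(W k).starProjection v‖ ^ 2 ≤ B * ‖v‖ ^ 2

/-- The fusion frame operator `∑ k, ν k ^ 2 • P k`, with `P k` the orthogonal projection
onto `W k`. -/
def fusionFrameOp {M K : ℕ} (W : Fin K → Submodule ℝ (EuclideanSpace ℝ (Fin M)))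
    (ν : Fin K → ℝ) : EuclideanSpace ℝ (Fin M) →L[ℝ] EuclideanSpace ℝ (Fin M) :=
  ∑ k, (ν k ^ 2) • (W k).starProjection

/-- `S` has spectrum `(lam m)`, counted with multiplicity: some orthonormal basis of `ℝ^M`
consists of eigenvectors of `S` for the eigenvalues `lam m`. -/
def HasSpectrum {M : ℕ} (S : EuclideanSpace ℝ (Fin M) →L[ℝ] EuclideanSpace ℝ (Fin M))
    (lam : Fin M → ℝ) : Prop :=
  ∃ b : OrthonormalBasis (Fin M) ℝ (EuclideanSpace ℝ (Fin M)), ∀ m, S (b m) = lam m • b m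

/-- The vectors `f n` and the partition of the index set into the sets `J k` generate the fusion
frame `(W k, ν k)`: each `(f n)` with `n ∈ J k` is a tight frame for `W k` with bound `ν k ^ 2`,
and the frame operator of `f` is the fusion frame operator. -/
structure Generates {M N K : ℕ} (f : Fin N → EuclideanSpace ℝ (Fin M)) (J : Fin K → Finset (Fin N))
    (W : Fin K → Submodule ℝ (EuclideanSpace ℝ (Fin M))) (ν : Fin K → ℝ) : Prop where
  disjoint : Pairwise fun k l => Disjoint (J k) (J l)
  cover : ∀ n, ∃ k, n ∈ J k
  isFusionFrame : IsFusionFrame W ν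
  tight : ∀ k, IsTightFrameOn f (J k) (W k) (ν k ^ 2)
  frameOp_eq : frameOp f = fusionFrameOp W ν

/-! ## The spectral tetris construction (STC) with the re-ordering procedure (STR) -/

/-- The standard basis vector `e_m` of `ℝ^M`. -/
abbrev e {M : ℕ} (m : Fin M) : EuclideanSpace ℝ (Fin M) := EuclideanSpace.single m 1

/-- The variables of the algorithm. Rows and columns are numbered from `0`. The norm that currently
stands in column `n` is `a (perm n)`, where `a` is the input sequence of norms. -/
structure State (M N : ℕ) where
  /-- the row of the cursor (the loop variable `m`) -/
  row : ℕ
  /-- the column of the cursor (the variable `n`) -/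
  col : ℕ
  /-- what is left of each prescribed eigenvalue -/
  lam : Fin M → ℝ
  /-- the current ordering of the norms -/
  perm : Equiv.Perm (Fin N)
  /-- the vectors written so far (`0` in the columns not yet reached) -/
  vec : Fin N → EuclideanSpace ℝ (Fin M)

/-- The initial state: cursor in the upper left corner, norms in the given order. -/
def init (M N : ℕ) (lam : Fin M → ℝ) : State M N where
  row := 0
  col := 0
  lam := lam
  perm := Equiv.refl _
  vec := 0

/-- The test at the end of the inner loop: the row is left when its eigenvalue is used up. -/
def State.endRow {M N : ℕ} (s : State M N) (m : Fin M) : State M N :=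
  if s.lam m = 0 then { s with row := s.row + 1 } else s

/-- Write the singleton `a_n e_m` in column `n`. -/
def State.singleton {M N : ℕ} (a : Fin N → ℝ) (s : State M N) (m : Fin M) (n : Fin N) :
    State M N :=
  { s with
    col := s.col + 1
    lam := Function.update s.lam m (s.lam m - a (s.perm n) ^ 2)
    vec := Function.update s.vec n (a (s.perm n) • e m) }

/-- Interchange the norms in the columns `n` and `n'`. -/
def State.interchange {M N : ℕ} (s : State M N) (n n' : Fin N) : State M N :=
  { s with perm := (Equiv.swap n n').trans s.perm }

/-- The first column of the `2 × 2` block with first row square sum `x`, for squared column norms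
`p` and `q`; the rows of the block are the coordinates `m` and `m'`. -/
def blockFst {M : ℕ} (m m' : Fin M) (x p q : ℝ) : EuclideanSpace ℝ (Fin M) :=
  let y := p + q - x
  if 2 * x = p + q then √(x / 2) • (e m + e m')
  else √(x * (p - y) / (x - y)) • e m + √(y * (x - p) / (x - y)) • e m'

/-- The second column of the `2 × 2` block. -/
def blockSnd {M : ℕ} (m m' : Fin M) (x p q : ℝ) : EuclideanSpace ℝ (Fin M) :=
  let y := p + q - x
  if 2 * x = p + q then √(x / 2) • (e m - e m')
  else √(x * (x - p) / (x - y)) • e m - √(y * (p - y) / (x - y)) • e m'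

/-- Write a `2 × 2` block in the rows `m`, `m'` and the columns `n`, `n'`. -/
def State.block {M N : ℕ} (a : Fin N → ℝ) (s : State M N) (m m' : Fin M) (n n' : Fin N) :
    State M N :=
  let x := s.lam m
  let p := a (s.perm n) ^ 2
  let q := a (s.perm n') ^ 2
  { s with
    col := s.col + 2
    lam := Function.update (Function.update s.lam m' (s.lam m' - (p + q - x))) m 0
    vec := Function.update (Function.update s.vec n (blockFst m m' x p q)) n'
      (blockSnd m m' x p q) }

/-- One pass through the inner loop of STC/STR for the input norms `a`. If the norm in the
current column still fits into the current row, a singleton is written. Otherwise a block is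
required; if the next norm is so small that no block exists, the two norms are interchanged and a
singleton is written, and else the block is written. The result is `none` when the cursor has left
the matrix, or when a block is required but there is no next row or no next column. -/
def step {M N : ℕ} (a : Fin N → ℝ) (s : State M N) : Option (State M N) :=
  if h : s.row < M ∧ s.col < N then
    let m : Fin M := ⟨s.row, h.1⟩
    let n : Fin N := ⟨s.col, h.2⟩
    if a (s.perm n) ^ 2 ≤ s.lam m then
      some ((s.singleton a m n).endRow m)
    else if h' : s.row + 1 < M ∧ s.col + 1 < N then
      let m' : Fin M := ⟨s.row + 1, h'.1⟩
      let n' : Fin N := ⟨s.col + 1, h'.2⟩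
      if a (s.perm n') ^ 2 < s.lam m then
        some (((s.interchange n n').singleton a m n).endRow m)
      else
        some ((s.block a m m' n n').endRow m)
    else none
  else none

/-- STC/STR, run on the norms `a` (in this order) and the eigenvalues `lam`, completes its
`M × N` synthesis matrix, and outputs the vectors `f` and the final ordering `σ` of the norms. -/
def Outputs {M N : ℕ} (a : Fin N → ℝ) (lam : Fin M → ℝ) (σ : Equiv.Perm (Fin N))
    (f : Fin N → EuclideanSpace ℝ (Fin M)) : Prop :=
  ∃ s ∈ StateTransition.eval (step a) (init M N lam),
    s.row = M ∧ s.col = N ∧ s.perm = σ ∧ s.vec = f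

/-! ## The arrangement of the weights -/

/-- The weight whose turn it is in column `n` of the arrangement `1, …, K, 1, …, K, …, 1, …, K`
(`d` rounds): the residue of `n` modulo `K`. -/
def cyc (d K : ℕ) (n : Fin (d * K)) : Fin K := n.modNat

end

end SpectralTetris

/-! Two things need proof: the run never gets stuck, and copies of the same weight in different
rounds give orthogonal vectors. Let `D` be the sum of the two largest squared weights and `C` the
square sum of a round, so that `D ≤ lam m` and `2 * lam m ≤ C`. Compare the partial sums `rowSum` of
the eigenvalues with the partial sums `colSum` of the squared norms in their original order.

An interchange delays a norm, but at most one norm is delayed at a time. It started out as a norm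
that overshoots the current row, it keeps overshooting, and it is eventually written in a block. It
is delayed by less than a round, so the two norms of a block have different positions in the round
and their squares add up to at most `D`. Hence a block always fits into the next row, and the trace
condition supplies the rows and columns needed.

A column with original index `j` meets row `m` only if `rowSum lam m ≤ colSum b (j + 1) < rowSum lam
(m + 1) + D`. This window has length `lam m + D ≤ 2 * lam m ≤ C`, whereas a full round shifts
`colSum` by `C`. So copies of one weight have disjoint supports. The vectors of one class are thus
orthogonal of equal norm `a k`, and their frame operator is `a k ^ 2` times a projection.
Orthogonality of the rows makes the whole frame operator diagonal with entries `lam m`. -/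

namespace SpectralTetris

open Finset

/-! ## Partial sums -/

/-- The sum of the first `r` eigenvalues. -/
noncomputable def rowSum {M : ℕ} (lam : Fin M → ℝ) (r : ℕ) : ℝ :=
  ∑ m, if m.val < r then lam m else 0

/-- The sum of the first `n` squared norms. -/
noncomputable def colSum (b : ℕ → ℝ) (n : ℕ) : ℝ := ∑ i ∈ range n, b i

lemma colSum_succ (b : ℕ → ℝ) (n : ℕ) : colSum b (n + 1) = colSum b n + b n :=
  sum_range_succ b n

lemma colSum_strictMono {b : ℕ → ℝ} (hb : ∀ n, 0 < b n) : StrictMono (colSum b) :=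
  strictMono_nat_of_lt_succ fun n => by rw [colSum_succ]; linarith [hb n]

lemma rowSum_zero {M : ℕ} (lam : Fin M → ℝ) : rowSum lam 0 = 0 := by simp [rowSum]

lemma rowSum_self {M : ℕ} (lam : Fin M → ℝ) : rowSum lam M = ∑ m, lam m := by simp [rowSum]

lemma rowSum_succ {M : ℕ} (lam : Fin M → ℝ) (m : Fin M) :
    rowSum lam (m + 1) = rowSum lam m + lam m := by
  have h : lam m = ∑ i, if i = m then lam i else 0 := by simp
  rw [h, rowSum, rowSum, ← sum_add_distrib]
  refine sum_congr rfl fun i _ => ?_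
  rcases lt_trichotomy i m with hi | hi | hi
  · rw [if_pos (by omega), if_pos (by omega), if_neg hi.ne, add_zero]
  · subst hi; simp
  · rw [if_neg (by omega), if_neg (by omega), if_neg hi.ne', add_zero]

lemma rowSum_mono {M : ℕ} {lam : Fin M → ℝ} (h : ∀ m, 0 ≤ lam m) : Monotone (rowSum lam) := by
  intro r s hrs
  refine sum_le_sum fun i _ => ?_
  split_ifs <;> first | omega | exact h i | exact le_rfl

/-! ## The `2 × 2` block -/

/-- The hypotheses force `x < y`, where `y = p + q - x`: all radicands are then nonnegative, and the
degenerate case `x = y` of the construction never occurs. -/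
lemma block_entries {x p q : ℝ} (hx : 0 < x) (hp : x < p) (hq : x ≤ q) :
    ∃ α β γ δ : ℝ, α ^ 2 + γ ^ 2 = x ∧ β ^ 2 + δ ^ 2 = p + q - x ∧ α * β = γ * δ ∧
      α ^ 2 + β ^ 2 = p ∧ γ ^ 2 + δ ^ 2 = q ∧
      ∀ {M : ℕ} (m m' : Fin M), blockFst m m' x p q = α • e m + β • e m' ∧
        blockSnd m m' x p q = γ • e m - δ • e m' := by
  set y := p + q - x with hy
  have hxy : x - y < 0 := by linarith
  have h1 : 0 ≤ x * (p - y) / (x - y) :=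
    div_nonneg_of_nonpos (mul_nonpos_of_nonneg_of_nonpos hx.le (by linarith)) hxy.le
  have h2 : 0 ≤ y * (x - p) / (x - y) :=
    div_nonneg_of_nonpos (mul_nonpos_of_nonneg_of_nonpos (by linarith) (by linarith)) hxy.le
  have h3 : 0 ≤ x * (x - p) / (x - y) :=
    div_nonneg_of_nonpos (mul_nonpos_of_nonneg_of_nonpos hx.le (by linarith)) hxy.le
  have h4 : 0 ≤ y * (p - y) / (x - y) :=
    div_nonneg_of_nonpos (mul_nonpos_of_nonneg_of_nonpos (by linarith) (by linarith)) hxy.le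
  refine ⟨√(x * (p - y) / (x - y)), √(y * (x - p) / (x - y)), √(x * (x - p) / (x - y)),
    √(y * (p - y) / (x - y)), ?_, ?_, ?_, ?_, ?_, fun m m' => ?_⟩
  · rw [Real.sq_sqrt h1, Real.sq_sqrt h3]; field_simp [hxy.ne]; ring
  · rw [Real.sq_sqrt h2, Real.sq_sqrt h4]; field_simp [hxy.ne]; ring
  · rw [← Real.sqrt_mul h1, ← Real.sqrt_mul h3]; congr 1; ring
  · rw [Real.sq_sqrt h1, Real.sq_sqrt h2]; field_simp [hxy.ne]; ring
  · rw [Real.sq_sqrt h3, Real.sq_sqrt h4]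
    have : q = x + y - p := by rw [hy]; ring
    rw [this]; field_simp [hxy.ne]; ring
  · have hne : 2 * x ≠ p + q := by linarith
    simp only [blockFst, blockSnd, if_neg hne, ← hy, and_self]

lemma norm_sq_two {M : ℕ} {m m' : Fin M} (h : m ≠ m') (α β : ℝ) :
    ‖α • e m + β • e m'‖ ^ 2 = α ^ 2 + β ^ 2 := by
  rw [norm_add_sq_real]
  simp [norm_smul, inner_smul_left, inner_smul_right, EuclideanSpace.inner_single_left, h, sq_abs]

/-! ## The invariant of the algorithm -/

lemma State.endRow_of_eq {M N : ℕ} (s : State M N) (m : Fin M) (h : s.lam m = 0) :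
    s.endRow m = { s with row := s.row + 1 } := if_pos h

lemma State.endRow_of_ne {M N : ℕ} (s : State M N) (m : Fin M) (h : s.lam m ≠ 0) :
    s.endRow m = s := if_neg h

lemma State.endRow_col {M N : ℕ} (s : State M N) (m : Fin M) : (s.endRow m).col = s.col := by
  unfold State.endRow; split_ifs <;> rfl


/-- The assumptions under which the algorithm is analysed: `b` extends the squared norms to all of
`ℕ`, `K` is the length of a round of norms with total `C`, and `D` bounds the sum of two squared
norms in different positions of a round. -/
structure Admissible {M N : ℕ} (w : Fin N → ℝ) (lam : Fin M → ℝ) (b : ℕ → ℝ) (K : ℕ)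
    (C D : ℝ) : Prop where
  sq : ∀ n, w n ^ 2 = b n
  pos : ∀ n, 0 < b n
  lt : ∀ n, b n < D
  add_le : ∀ i j, i % K ≠ j % K → b i + b j ≤ D
  le_lam : ∀ m, D ≤ lam m
  lam_le : ∀ m, 2 * lam m ≤ C
  two_mul_le : 2 * D ≤ C
  round : ∀ n, colSum b (n + K) = colSum b n + C
  trace : colSum b N = rowSum lam M

/-- What is known about the columns written so far. -/
structure Written {M N : ℕ} (lam : Fin M → ℝ) (b : ℕ → ℝ) (D : ℝ) (col : ℕ)
    (perm : Equiv.Perm (Fin N)) (vec : Fin N → EuclideanSpace ℝ (Fin M)) : Prop where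
  later : ∀ c : Fin N, col ≤ c → vec c = 0
  norm : ∀ c : Fin N, c < col → ‖vec c‖ ^ 2 = b (perm c)
  -- The window is stated for the original index `perm c`, so that interchanges do not blur the
  -- distance between copies of a weight.
  supp : ∀ (c : Fin N) (m : Fin M), vec c m ≠ 0 →
    rowSum lam m ≤ colSum b (perm c + 1) ∧ colSum b (perm c + 1) < rowSum lam (m + 1) + D

/-- The rows written so far are orthogonal, with the square sums that have been used up. -/
def GramEq {M N : ℕ} (lam μ : Fin M → ℝ) (vec : Fin N → EuclideanSpace ℝ (Fin M)) : Prop :=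
  ∀ m m', ∑ c, vec c m * vec c m' = if m = m' then lam m - μ m else 0

/-- The position of the cursor. One norm, the one in the current column, may have been delayed. -/
structure Cursor {M N : ℕ} (lam : Fin M → ℝ) (b : ℕ → ℝ) (μ : Fin M → ℝ)
    (perm : Equiv.Perm (Fin N)) (m : Fin M) (n : Fin N) : Prop where
  pos : 0 < μ m
  le : μ m ≤ lam m
  before : ∀ i, i < m → μ i = 0
  after : ∀ i, m < i → μ i = lam i
  -- The norms written so far are those with index at most `n`, except `perm n`; their total equals
  -- the eigenvalue mass used up.
  balance : μ m + colSum b (n + 1) = rowSum lam (m + 1) + b (perm n)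
  fixed : ∀ c, n < c → perm c = c
  perm_le : perm n ≤ n
  delayed : perm n < n → rowSum lam (m + 1) < colSum b (perm n + 1)

/-- The invariant of the algorithm. -/
structure Invariant {M N : ℕ} (lam : Fin M → ℝ) (b : ℕ → ℝ) (D : ℝ) (s : State M N) : Prop where
  written : Written lam b D s.col s.perm s.vec
  gram : GramEq lam s.lam s.vec
  cursor : (s.row = M ∧ s.col = N ∧ s.lam = 0) ∨
    ∃ (hm : s.row < M) (hn : s.col < N), Cursor lam b s.lam s.perm ⟨s.row, hm⟩ ⟨s.col, hn⟩

/-- The ordering may change in columns not yet written, which is what an interchange does. -/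
lemma Written.write {M N : ℕ} {lam : Fin M → ℝ} {b : ℕ → ℝ} {D : ℝ} {perm perm' : Equiv.Perm (Fin N)}
    {vec : Fin N → EuclideanSpace ℝ (Fin M)} {n : Fin N}
    (h : Written lam b D n perm vec) (hperm : ∀ c, c < n → perm' c = perm c)
    {v : EuclideanSpace ℝ (Fin M)} (hv : ‖v‖ ^ 2 = b (perm' n))
    (hs : ∀ m : Fin M, v m ≠ 0 → rowSum lam m ≤ colSum b (perm' n + 1) ∧
      colSum b (perm' n + 1) < rowSum lam (m + 1) + D) :
    Written lam b D (n + 1) perm' (Function.update vec n v) where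
  later c hc := by
    rw [Function.update_of_ne (by rintro rfl; omega)]
    exact h.later c (by omega)
  norm c hc := by
    by_cases hcn : c = n
    · subst hcn; simpa using hv
    · have : c < n := by omega
      rw [Function.update_of_ne hcn, hperm c this]
      exact h.norm c this
  supp c m hcm := by
    by_cases hcn : c = n
    · subst hcn
      rw [Function.update_self] at hcm
      exact hs m hcm
    · rw [Function.update_of_ne hcn] at hcm
      have : c < n := by
        by_contra hlt
        rw [h.later c (by omega)] at hcm
        simp at hcm
      rw [hperm c this]
      exact h.supp c m hcm

lemma sum_update_mul {M N : ℕ} {vec : Fin N → EuclideanSpace ℝ (Fin M)} {n : Fin N}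
    (h : vec n = 0) (v : EuclideanSpace ℝ (Fin M)) (i j : Fin M) :
    ∑ c, Function.update vec n v c i * Function.update vec n v c j =
      ∑ c, vec c i * vec c j + v i * v j := by
  have : v i * v j = ∑ c, if c = n then v i * v j else 0 := by simp
  rw [this, ← sum_add_distrib]
  refine sum_congr rfl fun c _ => ?_
  by_cases hc : c = n
  · subst hc; simp [h]
  · simp [hc]

/-! ### The balance equation, and preservation of the invariant by each kind of step -/

section Step

variable {M N K : ℕ} {w : Fin N → ℝ} {lam : Fin M → ℝ} {b : ℕ → ℝ} {C D : ℝ}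
  {μ : Fin M → ℝ} {perm : Equiv.Perm (Fin N)} {m : Fin M} {n : Fin N}

lemma Admissible.lam_pos (H : Admissible w lam b K C D) (m : Fin M) : 0 < lam m :=
  (H.pos 0).trans ((H.lt 0).trans_le (H.le_lam m))

lemma Admissible.rowSum_mono (H : Admissible w lam b K C D) : Monotone (rowSum lam) :=
  SpectralTetris.rowSum_mono fun m => (H.lam_pos m).le

lemma Admissible.colSum_le (H : Admissible w lam b K C D) {i j : ℕ} (h : i ≤ j) :
    colSum b i ≤ colSum b j := (colSum_strictMono H.pos).monotone h

/-- After the write, the remaining norms are exactly what is needed for the remaining rows. -/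
lemma Admissible.lt_of_colSum_lt (H : Admissible w lam b K C D) {c r : ℕ} (hr : r ≤ M)
    (h : colSum b c < rowSum lam r) : c < N := by
  have := h.trans_le (H.rowSum_mono hr)
  rw [← H.trace] at this
  exact (colSum_strictMono H.pos).lt_iff_lt.1 this

/-- The state after a row has been completed. -/
lemma cursor_next {μ : Fin M → ℝ} {r c : ℕ}
    (hr : r < M) (hc : c < N) (h0 : ∀ i : Fin M, i < r → μ i = 0)
    (hpos : 0 < μ ⟨r, hr⟩) (hle : μ ⟨r, hr⟩ ≤ lam ⟨r, hr⟩)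
    (h1 : ∀ i : Fin M, r < i → μ i = lam i)
    (hfix : ∀ i : Fin N, c ≤ i → perm i = i)
    (hbal : μ ⟨r, hr⟩ + colSum b c = rowSum lam (r + 1)) :
    Cursor lam b μ perm ⟨r, hr⟩ ⟨c, hc⟩ where
  pos := hpos
  le := hle
  before i hi := h0 i hi
  after i hi := h1 i hi
  balance := by
    rw [hfix ⟨c, hc⟩ le_rfl, colSum_succ]
    linarith
  fixed i hi := hfix i (le_of_lt hi)
  perm_le := (hfix ⟨c, hc⟩ le_rfl).le
  delayed h := by rw [hfix ⟨c, hc⟩ le_rfl] at h; exact absurd h (lt_irrefl _)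

/-- A delayed norm overshoots the row, so by the balance equation it exceeds what is left there. It
can therefore only be written in a block. -/
lemma Cursor.perm_eq_of_le (h : Cursor lam b μ perm m n) (H : Admissible w lam b K C D)
    (hb : b (perm n) ≤ μ m) : perm n = n := by
  refine le_antisymm h.perm_le (not_lt.1 fun hlt => ?_)
  have h1 := h.delayed hlt
  have h2 := H.colSum_le (show (perm n : ℕ) + 1 ≤ n + 1 by have := h.perm_le; omega)
  linarith [h.balance]

lemma Cursor.lt_colSum (h : Cursor lam b μ perm m n) (hb : μ m < b (perm n)) :
    rowSum lam (m + 1) < colSum b (perm n + 1) := by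
  rcases h.perm_le.lt_or_eq with hlt | heq
  · exact h.delayed hlt
  · have := h.balance
    rw [heq] at hb this ⊢
    linarith

/-- A block is written only if its two norms are in different positions of the round. -/
lemma Cursor.add_le (h : Cursor lam b μ perm m n) (H : Admissible w lam b K C D)
    (hb : μ m < b (perm n)) : b (perm n) + b (n + 1) ≤ D := by
  refine H.add_le _ _ fun hmod => ?_
  have h1 := h.lt_colSum hb
  have h2 := colSum_succ b (perm n)
  -- The balance equation and `h1` bound the left side by `colSum b (perm n) + 2 * b (perm n)`, and
  -- `2 * b (perm n) < 2 * D ≤ C`. So `n + 1` lies less than one round after `perm n`.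
  have h3 : colSum b (n + 1) < colSum b (perm n + K) := by
    rw [H.round]
    linarith [h.balance, h.pos, H.lt (perm n), H.two_mul_le]
  have h4 := (colSum_strictMono H.pos).lt_iff_lt.1 h3
  have h5 : (perm n : ℕ) < n + 1 := by have := h.perm_le; omega
  have h6 := (Nat.modEq_iff_dvd' h5.le).1 hmod
  have := Nat.le_of_dvd (by omega) h6
  omega

/-- Whenever a block is required there is a next row. -/
lemma Cursor.row_lt (h : Cursor lam b μ perm m n) (H : Admissible w lam b K C D)
    (hb : μ m < b (perm n)) : m.val + 1 < M := by
  by_contra hM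
  have h1 : rowSum lam (m + 1) = colSum b N := by
    rw [H.trace]; congr 1; omega
  have h2 := H.colSum_le (show n.val + 1 ≤ N by omega)
  linarith [h.balance]

/-- Whenever a block is required there is a next column. -/
lemma Cursor.col_lt (h : Cursor lam b μ perm m n) (H : Admissible w lam b K C D)
    (hb : μ m < b (perm n)) : n.val + 1 < N := by
  have hM := h.row_lt H hb
  have h1 := rowSum_succ lam ⟨m + 1, hM⟩
  refine H.lt_of_colSum_lt (r := m + 1 + 1) hM ?_
  simp only at h1
  rw [h1]
  linarith [h.balance, h.pos, H.lt (perm n), H.le_lam ⟨m + 1, hM⟩]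

lemma Cursor.rowSum_add_le (h : Cursor lam b μ perm m n) :
    rowSum lam m + b (perm n) ≤ colSum b (n + 1) := by
  linarith [h.balance, h.le, rowSum_succ lam m]

lemma gramEq_singleton {vec : Fin N → EuclideanSpace ℝ (Fin M)} (h : GramEq lam μ vec)
    (hn : vec n = 0) (α : ℝ) :
    GramEq lam (Function.update μ m (μ m - α ^ 2)) (Function.update vec n (α • e m)) := by
  intro i j
  rw [sum_update_mul hn, h i j]
  by_cases hij : i = j
  · subst hij
    by_cases hi : i = m
    · subst hi; simp; ring
    · simp [hi]
  · by_cases hi : i = m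
    · have : j ≠ m := fun hj => hij (hi.trans hj.symm)
      simp [hij, this]
    · simp [hij, hi]

/-- The relation `α * β = γ * δ` cancels the only new inner product between different rows. -/
lemma gramEq_block {vec : Fin N → EuclideanSpace ℝ (Fin M)} {m' : Fin M} {n' : Fin N}
    (h : GramEq lam μ vec) (hn : vec n = 0) (hn' : vec n' = 0) (hmm : m ≠ m') (hnn : n ≠ n')
    {y α β γ δ : ℝ} (h1 : α ^ 2 + γ ^ 2 = μ m) (h2 : β ^ 2 + δ ^ 2 = y) (h3 : α * β = γ * δ) :
    GramEq lam (Function.update (Function.update μ m' (μ m' - y)) m 0)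
      (Function.update (Function.update vec n (α • e m + β • e m')) n'
        (γ • e m - δ • e m')) := by
  intro i j
  rw [sum_update_mul (by rw [Function.update_of_ne hnn.symm, hn']), sum_update_mul hn, h i j]
  have hmm' := hmm.symm
  by_cases hi : i = m
  · subst hi
    by_cases hj : j = i
    · subst hj; simp [hmm]; linarith
    · by_cases hj' : j = m'
      · subst hj'; simp [hmm, hmm']; linarith
      · simp [hj, hj', Ne.symm hj, hmm]
  · by_cases hi' : i = m'
    · subst hi'
      by_cases hj : j = m
      · subst hj; simp [hmm, hmm']; linarith
      · by_cases hj' : j = i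
        · subst hj'; simp [hmm']; linarith
        · simp [hj, hj', Ne.symm hj', hmm']
    · by_cases hij : i = j
      · subst hij; simp [hi, hi']
      · simp [hi, hi', hij]

lemma smul_e_apply_ne_zero {α : ℝ} {m i : Fin M} (h : (α • e m : EuclideanSpace ℝ (Fin M)) i ≠ 0) :
    i = m := by
  by_contra hi
  simp [hi] at h

lemma add_smul_e_apply_ne_zero {α β : ℝ} {m m' i : Fin M}
    (h : (α • e m + β • e m' : EuclideanSpace ℝ (Fin M)) i ≠ 0) : i = m ∨ i = m' := by
  by_contra! hi
  simp [hi.1, hi.2] at h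

lemma norm_sq_smul_e (α : ℝ) (m : Fin M) :
    ‖(α • e m : EuclideanSpace ℝ (Fin M))‖ ^ 2 = α ^ 2 := by
  simp [norm_smul, sq_abs]

/-- A singleton without an interchange preserves the invariant. -/
lemma invariant_singleton (H : Admissible w lam b K C D) {s : State M N}
    (hs : Invariant lam b D s) {hm : s.row < M} {hn : s.col < N}
    (hc : Cursor lam b s.lam s.perm ⟨s.row, hm⟩ ⟨s.col, hn⟩)
    (hle : w (s.perm ⟨s.col, hn⟩) ^ 2 ≤ s.lam ⟨s.row, hm⟩) :
    Invariant lam b D ((s.singleton w ⟨s.row, hm⟩ ⟨s.col, hn⟩).endRow ⟨s.row, hm⟩) := by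
  obtain ⟨row, col, μ, perm, vec⟩ := s
  obtain ⟨hw, hg, -⟩ := hs
  simp only at *
  set m : Fin M := ⟨row, hm⟩ with hmdef
  set n : Fin N := ⟨col, hn⟩ with hndef
  have hle' := hle
  rw [H.sq] at hle'
  have hpn : perm n = n := hc.perm_eq_of_le H hle'
  have hbal := hc.balance
  have hlow := hc.rowSum_add_le
  have hsq := H.sq (perm n)
  have hD : 0 < D := (H.pos 0).trans (H.lt 0)
  have hW : Written lam b D (col + 1) perm (Function.update vec n (w (perm n) • e m)) := by
    refine Written.write (n := n) hw (fun c _ => rfl) (by rw [norm_sq_smul_e, hsq]) fun i hi => ?_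
    obtain rfl := smul_e_apply_ne_zero hi
    have := H.pos (perm n)
    constructor
    · rw [hpn] at *; linarith
    · have : (perm n : ℕ) + 1 = n + 1 := by rw [hpn]
      rw [this]; linarith
  have hG := gramEq_singleton (m := m) hg (hw.later n le_rfl) (w (perm n))
  have hfix : ∀ i : Fin N, col + 1 ≤ i → perm i = i := fun i hi => hc.fixed i hi
  have hS : colSum b (col + 1) = rowSum lam (row + 1) + b (perm n) - μ m := by linarith
  by_cases h0 : Function.update μ m (μ m - w (perm n) ^ 2) m = 0
  · rw [State.endRow_of_eq]; swap
    · exact h0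
    simp only [State.singleton]
    refine ⟨hW, hG, ?_⟩
    rw [Function.update_self, hsq] at h0
    rcases (show row + 1 ≤ M from hm).eq_or_lt with hM | hM
    · left
      refine ⟨hM, ?_, ?_⟩
      -- When the last row is used up, the trace condition leaves no norm over.
      · refine (colSum_strictMono H.pos).injective ?_
        simp only
        have hMr : rowSum lam (row + 1) = rowSum lam M := congrArg _ hM
        rw [H.trace, hS, hMr]; linarith
      · funext i
        by_cases hi : i = m
        · subst hi; simp only [Function.update_self, Pi.zero_apply]; rw [hsq]; linarith
        · simp only [Function.update_of_ne hi]
          have hv : i.val ≠ row := fun h => hi (Fin.ext h)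
          exact hc.before i (show i.val < row by omega)
    · right
      have hlt : col + 1 < N := by
        refine H.lt_of_colSum_lt (r := row + 1 + 1) hM ?_
        have := rowSum_succ lam ⟨row + 1, hM⟩
        have := H.lam_pos ⟨row + 1, hM⟩
        simp only at *
        linarith
      have hne : (⟨row + 1, hM⟩ : Fin M) ≠ m := by simp [hmdef]
      have hval : μ ⟨row + 1, hM⟩ = lam ⟨row + 1, hM⟩ := hc.after _ (by simp [hmdef])
      refine ⟨hM, hlt, cursor_next hM hlt ?_ ?_ ?_ ?_ hfix ?_⟩
      · intro i hi
        by_cases him : i = m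
        · subst him; simp only [Function.update_self]; rw [hsq]; linarith
        · simp only [Function.update_of_ne him]
          have hv : i.val ≠ row := fun h => him (Fin.ext h)
          exact hc.before i (show i.val < row from lt_of_le_of_ne (Nat.lt_succ_iff.1 hi) hv)
      · simp only [Function.update_of_ne hne, hval]; exact H.lam_pos _
      · simp only [Function.update_of_ne hne, hval]; exact le_rfl
      · intro i hi
        have him : i ≠ m := by rintro rfl; simp [hmdef] at hi
        simp only [Function.update_of_ne him]
        exact hc.after i (show row < i.val from (Nat.lt_succ_self row).trans hi)
      · simp only [Function.update_of_ne hne, hval]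
        have := rowSum_succ lam ⟨row + 1, hM⟩
        simp only at this
        linarith
  · rw [State.endRow_of_ne]; swap
    · exact h0
    simp only [State.singleton]
    refine ⟨hW, hG, Or.inr ?_⟩
    rw [Function.update_self, hsq] at h0
    have hpos : 0 < μ m - b (perm n) := lt_of_le_of_ne (by linarith) (Ne.symm h0)
    have hlt : col + 1 < N := H.lt_of_colSum_lt (r := row + 1) hm (by linarith)
    refine ⟨hm, hlt, cursor_next hm hlt ?_ ?_ ?_ ?_ hfix ?_⟩
    · intro i hi
      have him : i ≠ m := by rintro rfl; simp [hmdef] at hi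
      simp only [Function.update_of_ne him]
      exact hc.before i hi
    · simp only [← hmdef, Function.update_self]; rw [hsq]; exact hpos
    · simp only [← hmdef, Function.update_self]; rw [hsq]; linarith [hc.le, H.pos (perm n)]
    · intro i hi
      have him : i ≠ m := by rintro rfl; simp [hmdef] at hi
      simp only [Function.update_of_ne him]
      exact hc.after i hi
    · simp only [← hmdef, Function.update_self]; rw [hsq]; linarith

/-- An interchange and the singleton after it preserve the invariant. -/
lemma invariant_interchange (H : Admissible w lam b K C D) {s : State M N}
    (hs : Invariant lam b D s) {hm : s.row < M} {hn : s.col < N}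
    (hc : Cursor lam b s.lam s.perm ⟨s.row, hm⟩ ⟨s.col, hn⟩) (hn' : s.col + 1 < N)
    (hlt : s.lam ⟨s.row, hm⟩ < w (s.perm ⟨s.col, hn⟩) ^ 2)
    (hlt' : w (s.perm ⟨s.col + 1, hn'⟩) ^ 2 < s.lam ⟨s.row, hm⟩) :
    Invariant lam b D (((s.interchange ⟨s.col, hn⟩ ⟨s.col + 1, hn'⟩).singleton w ⟨s.row, hm⟩
      ⟨s.col, hn⟩).endRow ⟨s.row, hm⟩) := by
  obtain ⟨row, col, μ, perm, vec⟩ := s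
  obtain ⟨hw, hg, -⟩ := hs
  simp only at *
  set m : Fin M := ⟨row, hm⟩ with hmdef
  set n : Fin N := ⟨col, hn⟩ with hndef
  set n' : Fin N := ⟨col + 1, hn'⟩ with hndef'
  have hpn' : perm n' = n' := hc.fixed n' (by simp [hndef, hndef'])
  set perm' := (Equiv.swap n n').trans perm with hperm'
  have hpn1 : perm' n = n' := by simp [hperm', hpn']
  have hpn2 : perm' n' = perm n := by simp [hperm']
  have hpc : ∀ c, c ≠ n → c ≠ n' → perm' c = perm c := fun c h1 h2 => by
    simp [hperm', Equiv.swap_apply_of_ne_of_ne h1 h2]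
  have hsq : w (perm' n) ^ 2 = b (col + 1) := by rw [hpn1, H.sq]
  have hlt1 := hlt
  rw [H.sq] at hlt1
  have hlt2 : b (col + 1) < μ m := by rw [hpn', H.sq] at hlt'; exact hlt'
  have hbal := hc.balance
  have hlow := hc.rowSum_add_le
  have hS2 := colSum_succ b (col + 1)
  simp only [show n.val = col from rfl, show m.val = row from rfl] at hbal hlow
  have hW : Written lam b D (col + 1) perm' (Function.update vec n (w (perm' n) • e m)) := by
    refine Written.write (n := n) hw (fun c hcn => hpc c hcn.ne ?_)
      (by rw [norm_sq_smul_e, H.sq]) fun i hi => ?_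
    · rintro rfl; rw [Fin.lt_def] at hcn; simp [hndef, hndef'] at hcn
    · obtain rfl := smul_e_apply_ne_zero hi
      rw [hpn1]
      simp only [show n'.val = col + 1 from rfl, show m.val = row from rfl]
      constructor
      · linarith [H.pos (perm n), H.pos (col + 1)]
      · linarith [H.lt (perm n)]
  have hG := gramEq_singleton (m := m) hg (hw.later n le_rfl) (w (perm' n))
  -- The interchanged norm fits strictly, so the row is not finished and the delayed norm stays in
  -- the same row.
  have h0 : Function.update μ m (μ m - w (perm' n) ^ 2) m ≠ 0 := by
    rw [Function.update_self, hsq]; linarith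
  simp only [State.interchange, State.singleton, State.endRow, if_neg h0, ← hperm']
  refine ⟨hW, hG, Or.inr ⟨hm, hn', ?_⟩⟩
  simp only [← hmdef, ← hndef']
  refine ⟨?_, ?_, ?_, ?_, ?_, ?_, ?_, ?_⟩
  · rw [Function.update_self, hsq]; linarith
  · rw [Function.update_self, hsq]; linarith [hc.le, H.pos (col + 1)]
  · intro i hi
    rw [Function.update_of_ne hi.ne]; exact hc.before i hi
  · intro i hi
    rw [Function.update_of_ne hi.ne']; exact hc.after i hi
  · rw [Function.update_self, hsq, hpn2]
    simp only [show n'.val = col + 1 from rfl, show m.val = row from rfl]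
    linarith
  · intro c hcn
    have h1 : n < c := lt_trans (by simp [hndef, hndef']) hcn
    rw [hpc c h1.ne' hcn.ne']; exact hc.fixed c h1
  · rw [hpn2]; exact hc.perm_le.trans (by simp [hndef, hndef'])
  · intro _
    rw [hpn2]; exact hc.lt_colSum hlt1

/-- A block preserves the invariant. -/
lemma invariant_block (H : Admissible w lam b K C D) {s : State M N}
    (hs : Invariant lam b D s) {hm : s.row < M} {hn : s.col < N}
    (hc : Cursor lam b s.lam s.perm ⟨s.row, hm⟩ ⟨s.col, hn⟩)
    (hm' : s.row + 1 < M) (hn' : s.col + 1 < N)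
    (hlt : s.lam ⟨s.row, hm⟩ < w (s.perm ⟨s.col, hn⟩) ^ 2)
    (hle : s.lam ⟨s.row, hm⟩ ≤ w (s.perm ⟨s.col + 1, hn'⟩) ^ 2) :
    Invariant lam b D ((s.block w ⟨s.row, hm⟩ ⟨s.row + 1, hm'⟩ ⟨s.col, hn⟩
      ⟨s.col + 1, hn'⟩).endRow ⟨s.row, hm⟩) := by
  obtain ⟨row, col, μ, perm, vec⟩ := s
  obtain ⟨hw, hg, -⟩ := hs
  simp only at *
  set m : Fin M := ⟨row, hm⟩ with hmdef
  set m' : Fin M := ⟨row + 1, hm'⟩ with hmdef'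
  set n : Fin N := ⟨col, hn⟩ with hndef
  set n' : Fin N := ⟨col + 1, hn'⟩ with hndef'
  have hmm : m ≠ m' := by simp [hmdef, hmdef']
  have hnn : n ≠ n' := by simp [hndef, hndef']
  have hpn' : perm n' = n' := hc.fixed n' (by simp [hndef, hndef'])
  have hp : w (perm n) ^ 2 = b (perm n) := H.sq _
  have hq : w (perm n') ^ 2 = b (col + 1) := by rw [hpn', H.sq]
  have hlt1 := hlt
  rw [hp] at hlt1
  have hbal := hc.balance
  have hlow := hc.rowSum_add_le
  have hadd := hc.add_le H hlt1
  have hrow := hc.lt_colSum hlt1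
  have hT := rowSum_succ lam m
  have hT' := rowSum_succ lam m'
  have hS2 := colSum_succ b (col + 1)
  have hx := hc.pos
  have hxl := hc.le
  have hD := H.le_lam m'
  have hDp := H.lt (perm n)
  simp only [show n.val = col from rfl, show m.val = row from rfl,
    show m'.val = row + 1 from rfl] at hbal hlow hadd hrow hT hT'
  have hS1 := H.colSum_le (show (perm n : ℕ) + 1 ≤ col + 1 from Nat.succ_le_succ hc.perm_le)
  obtain ⟨α, β, γ, δ, h1, h2, h3, h4, h5, h6⟩ := block_entries hx hlt hle
  obtain ⟨hf, hg'⟩ := h6 m m'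
  have hG := gramEq_block (y := w (perm n) ^ 2 + w (perm n') ^ 2 - μ m) hg (hw.later n le_rfl)
    (hw.later n' (by simp [hndef'])) hmm hnn h1 h2 h3
  have hW1 : Written lam b D (col + 1) perm (Function.update vec n (α • e m + β • e m')) := by
    refine Written.write (n := n) hw (fun c _ => rfl) (by rw [norm_sq_two hmm, h4, hp]) fun i hi => ?_
    rcases add_smul_e_apply_ne_zero hi with rfl | rfl
    · constructor
      · simp only [show m.val = row from rfl]; linarith
      · simp only [show m.val = row from rfl]; linarith
    · simp only [show m'.val = row + 1 from rfl]
      constructor <;> linarith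
  have hW : Written lam b D (col + 2) perm (Function.update
      (Function.update vec n (α • e m + β • e m')) n' (γ • e m - δ • e m')) := by
    rw [sub_eq_add_neg, ← neg_smul]
    refine Written.write (n := n') hW1 (fun c _ => rfl)
      (by rw [norm_sq_two hmm, neg_sq, h5, H.sq]) fun i hi => ?_
    rw [hpn']
    simp only [show n'.val = col + 1 from rfl]
    rcases add_smul_e_apply_ne_zero hi with rfl | rfl
    · simp only [show m.val = row from rfl]
      constructor <;> linarith
    · simp only [show m'.val = row + 1 from rfl]
      constructor <;> linarith
  rw [← hf, ← hg'] at hG hW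
  simp only [State.block, State.endRow, Function.update_self, if_true]
  refine ⟨hW, hG, Or.inr ?_⟩
  have hval : μ m' = lam m' := hc.after m' (by simp [hmdef, hmdef'])
  have hS : colSum b (col + 2) = rowSum lam (row + 1) + b (perm n) + b (col + 1) - μ m := by
    linarith
  have hlt' : col + 2 < N := H.lt_of_colSum_lt (r := row + 1 + 1) hm' (by linarith)
  refine ⟨hm', hlt', cursor_next hm' hlt' ?_ ?_ ?_ ?_ ?_ ?_⟩
  · intro i hi
    by_cases him : i = m
    · subst him; simp
    · have hv : i.val ≠ row := fun h => him (Fin.ext h)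
      have him' : i ≠ m' := by rintro rfl; simp [hmdef'] at hi
      simp only [Function.update_of_ne him, Function.update_of_ne him']
      exact hc.before i (show i.val < row from lt_of_le_of_ne (Nat.lt_succ_iff.1 hi) hv)
  -- The block takes `p + q - x < p + q ≤ D ≤ lam m'` from the next row, so something remains there.
  · simp only [← hmdef', Function.update_of_ne hmm.symm, Function.update_self]
    rw [hp, hq, hval]; linarith
  · simp only [← hmdef', Function.update_of_ne hmm.symm, Function.update_self]
    rw [hp, hq, hval]; linarith [H.pos (col + 1)]
  · intro i hi
    have him : i ≠ m := by rintro rfl; simp [hmdef] at hi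
    have him' : i ≠ m' := by rintro rfl; simp [hmdef'] at hi
    simp only [Function.update_of_ne him, Function.update_of_ne him']
    exact hc.after i (show row < i.val from (Nat.lt_succ_self row).trans hi)
  · intro i hi
    exact hc.fixed i (show col < i.val from lt_of_lt_of_le (by simp) hi)
  · simp only [← hmdef', Function.update_of_ne hmm.symm, Function.update_self]
    rw [hp, hq, hval]; linarith

end Step

/-! ## The run of the algorithm -/

/-- A run that is not finished can be continued, and the cursor moves to the right. -/
lemma Invariant.step {M N K : ℕ} {w : Fin N → ℝ} {lam : Fin M → ℝ} {b : ℕ → ℝ} {C D : ℝ}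
    (H : Admissible w lam b K C D) {s : State M N} (hs : Invariant lam b D s) :
    (s.row = M ∧ s.col = N ∧ s.lam = 0 ∧ step w s = none) ∨
      ∃ s', step w s = some s' ∧ s.col < s'.col ∧ s.col < N ∧ Invariant lam b D s' := by
  rcases hs.cursor with ⟨h1, h2, h3⟩ | ⟨hm, hn, hc⟩
  · left
    exact ⟨h1, h2, h3, by simp [SpectralTetris.step, h1]⟩
  · right
    unfold SpectralTetris.step
    rw [dif_pos ⟨hm, hn⟩]
    simp only
    split_ifs with h1 h2 h3
    · refine ⟨_, rfl, ?_, hn, invariant_singleton H hs hc h1⟩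
      rw [State.endRow_col]; exact Nat.lt_succ_self _
    · refine ⟨_, rfl, ?_, hn, invariant_interchange H hs hc h2.2 (not_le.1 h1) h3⟩
      rw [State.endRow_col]; exact Nat.lt_succ_self _
    · refine ⟨_, rfl, ?_, hn, invariant_block H hs hc h2.1 h2.2 (not_le.1 h1) (not_lt.1 h3)⟩
      rw [State.endRow_col]; exact Nat.lt_add_of_pos_right two_pos
    -- The branch returning `none` needs a missing row or column, and neither can be missing when a
    -- block is required.
    · refine absurd ⟨hc.row_lt H ?_, hc.col_lt H ?_⟩ h2 <;>
      · rw [← H.sq]; exact not_le.1 h1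

lemma Invariant.exists_eval {M N K : ℕ} {w : Fin N → ℝ} {lam : Fin M → ℝ} {b : ℕ → ℝ} {C D : ℝ}
    (H : Admissible w lam b K C D) {s : State M N} (hs : Invariant lam b D s) :
    ∃ t ∈ StateTransition.eval (SpectralTetris.step w) s,
      t.row = M ∧ t.col = N ∧ t.lam = 0 ∧ Invariant lam b D t := by
  induction hk : N - s.col using Nat.strong_induction_on generalizing s with
  | _ k ih =>
    rcases hs.step H with ⟨h1, h2, h3, h4⟩ | ⟨s', h1, h2, h3, h4⟩
    · exact ⟨s, StateTransition.mem_eval.2 ⟨.refl, h4⟩, h1, h2, h3, hs⟩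
    · obtain ⟨t, ht, h⟩ := ih (N - s'.col) (by omega) h4 rfl
      obtain ⟨hr, hn⟩ := StateTransition.mem_eval.1 ht
      exact ⟨t, StateTransition.mem_eval.2 ⟨.head h1 hr, hn⟩, h⟩

lemma invariant_init {M N K : ℕ} {w : Fin N → ℝ} {lam : Fin M → ℝ} {b : ℕ → ℝ} {C D : ℝ}
    (H : Admissible w lam b K C D) (hM : 1 ≤ M) : Invariant lam b D (init M N lam) where
  written := ⟨fun _ _ => rfl, fun c hc => absurd hc (Nat.not_lt_zero _),
    fun c m h => by simp [init] at h⟩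
  gram i j := by simp [init]
  cursor := by
    right
    have h1 := rowSum_succ lam ⟨0, hM⟩
    simp only [rowSum_zero, zero_add] at h1
    have h2 := H.lam_pos ⟨0, hM⟩
    have h3 : colSum b 0 = 0 := by simp [colSum]
    -- The positive trace excludes an empty matrix; this covers `d = 0`.
    have hN : 0 < N := H.lt_of_colSum_lt (r := 1) hM (by linarith)
    exact ⟨hM, hN, cursor_next (μ := lam) (r := 0) (c := 0) hM hN (fun i hi => absurd hi (Nat.not_lt_zero _)) h2 le_rfl
      (fun _ _ => rfl) (fun _ _ => rfl) (by simp only [zero_add]; linarith)⟩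

/-- The algorithm completes the synthesis matrix: the columns have the prescribed norms, the rows
are orthogonal with the prescribed square sums, and columns that stand for the same position of
different rounds are orthogonal. -/
theorem exists_outputs {M N K : ℕ} {w : Fin N → ℝ} {lam : Fin M → ℝ} {b : ℕ → ℝ} {C D : ℝ}
    (H : Admissible w lam b K C D) (hM : 1 ≤ M) :
    ∃ (σ : Equiv.Perm (Fin N)) (f : Fin N → EuclideanSpace ℝ (Fin M)),
      Outputs w lam σ f ∧ (∀ n, ‖f n‖ ^ 2 = w (σ n) ^ 2) ∧
      (∀ m m', ∑ n, f n m * f n m' = if m = m' then lam m else 0) ∧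
      ∀ n n', n ≠ n' → (σ n).val % K = (σ n').val % K → inner ℝ (f n) (f n') = 0 := by
  obtain ⟨t, ht, h1, h2, h3, hI⟩ := (invariant_init H hM).exists_eval H
  refine ⟨t.perm, t.vec, ⟨t, ht, h1, h2, rfl, rfl⟩, fun n => ?_, fun m m' => ?_,
    fun n n' hne hmod => ?_⟩
  · rw [H.sq]; exact hI.written.norm n (by omega)
  · have := hI.gram m m'
    rw [h3] at this
    simpa using this
  -- Congruent indices differ by at least `K`, so their partial sums differ by at least `C`, too
  -- much for both to lie in the window of one row.
  · have key : ∀ c c' : Fin N, t.perm c < t.perm c' →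
        (t.perm c).val % K = (t.perm c').val % K → ∀ m, t.vec c m * t.vec c' m = 0 := by
      intro c c' hlt hmod m
      by_contra hmul
      obtain ⟨hc, hc'⟩ := mul_ne_zero_iff.1 hmul
      have h4 := (hI.written.supp c m hc).1
      have h5 := (hI.written.supp c' m hc').2
      have h6 := (Nat.modEq_iff_dvd' (Fin.lt_def.1 hlt).le).1 hmod
      have h7 := Nat.le_of_dvd (by have := Fin.lt_def.1 hlt; omega) h6
      have h8 := H.colSum_le (show (t.perm c).val + 1 + K ≤ t.perm c' + 1 by
        have := Fin.lt_def.1 hlt; omega)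
      rw [H.round] at h8
      linarith [rowSum_succ lam m, H.le_lam m, H.lam_le m]
    have hin : ∀ m, t.vec n m * t.vec n' m = 0 := by
      intro m
      rcases lt_or_gt_of_ne (fun h => hne (t.perm.injective h) : t.perm n ≠ t.perm n') with h | h
      · exact key n n' h hmod m
      · rw [mul_comm]; exact key n' n h hmod.symm m
    rw [PiLp.inner_apply]
    refine sum_eq_zero fun m _ => ?_
    simpa [mul_comm] using hin m

/-! ## Orthogonal families of vectors of equal norm -/

section Orthogonal

variable {M N : ℕ} {f : Fin N → EuclideanSpace ℝ (Fin M)} {J : Finset (Fin N)} {c : ℝ}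

/-- The vectors `c⁻¹ • f n` form an orthonormal basis of the span, and this is the Fourier expansion
of the projection multiplied by `c ^ 2`. -/
lemma smul_starProjection_span (hc : 0 < c) (hf : ∀ n ∈ J, ‖f n‖ = c)
    (ho : ∀ n ∈ J, ∀ n' ∈ J, n ≠ n' → inner ℝ (f n) (f n') = 0)
    (v : EuclideanSpace ℝ (Fin M)) :
    c ^ 2 • (Submodule.span ℝ (f '' (J : Set (Fin N)))).starProjection v =
      ∑ n ∈ J, inner ℝ (f n) v • f n := by
  have hc2 : c ^ 2 ≠ 0 := by positivity
  rw [Submodule.eq_starProjection_of_mem_of_inner_eq_zero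
    (v := (c ^ 2)⁻¹ • ∑ n ∈ J, inner ℝ (f n) v • f n), smul_inv_smul₀ hc2]
  · refine Submodule.smul_mem _ _ (Submodule.sum_mem _ fun n hn => Submodule.smul_mem _ _ ?_)
    exact Submodule.subset_span ⟨n, hn, rfl⟩
  · intro w hw
    induction hw using Submodule.span_induction with
    | mem x hx =>
      obtain ⟨n, hn, rfl⟩ := hx
      have hn : n ∈ J := hn
      rw [inner_sub_left, inner_smul_left, sum_inner, sum_eq_single_of_mem n hn]
      · rw [inner_smul_left, real_inner_self_eq_norm_sq, hf n hn, real_inner_comm (f n) v]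
        simp only [conj_trivial]
        field_simp
        ring
      · intro i hi hin
        rw [inner_smul_left, ho i hi n hn hin, mul_zero]
    | zero => simp
    | add x y _ _ hx hy => rw [inner_add_right, hx, hy, add_zero]
    | smul r x _ hx => rw [inner_smul_right, hx, mul_zero]

lemma finrank_span_image_of_orthogonal (hc : 0 < c) (hf : ∀ n ∈ J, ‖f n‖ = c)
    (ho : ∀ n ∈ J, ∀ n' ∈ J, n ≠ n' → inner ℝ (f n) (f n') = 0) :
    Module.finrank ℝ (Submodule.span ℝ (f '' (J : Set (Fin N)))) = #J := by
  have hli : LinearIndependent ℝ fun n : J => f n := by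
    refine linearIndependent_of_ne_zero_of_inner_eq_zero (fun n => ?_) fun n n' hne => ?_
    · rw [← norm_ne_zero_iff, hf n n.2]; exact hc.ne'
    · exact ho n n.2 n' n'.2 fun h => hne (Subtype.ext h)
  have := finrank_span_eq_card hli
  rw [Fintype.card_coe] at this
  rw [← this, Set.image_eq_range]
  rfl

lemma isTightFrameOn_span (hc : 0 < c) (hf : ∀ n ∈ J, ‖f n‖ = c)
    (ho : ∀ n ∈ J, ∀ n' ∈ J, n ≠ n' → inner ℝ (f n) (f n') = 0) :
    IsTightFrameOn f J (Submodule.span ℝ (f '' (J : Set (Fin N)))) (c ^ 2) := by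
  refine ⟨by positivity, fun n hn => Submodule.subset_span ⟨n, hn, rfl⟩, fun v hv => ?_⟩
  have h := congrArg (inner ℝ v) (smul_starProjection_span hc hf ho v)
  rw [Submodule.starProjection_eq_self_iff.2 hv, inner_smul_right, real_inner_self_eq_norm_sq,
    inner_sum] at h
  rw [h]
  refine sum_congr rfl fun n _ => ?_
  rw [inner_smul_right, real_inner_comm, sq]

end Orthogonal

/-! ## Fusion frame operators -/

/-- In coordinates the frame operator is the Gram matrix of the rows of the synthesis matrix. -/
lemma frameOp_single {M N : ℕ} {f : Fin N → EuclideanSpace ℝ (Fin M)} {lam : Fin M → ℝ}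
    (h : ∀ m m', ∑ n, f n m * f n m' = if m = m' then lam m else 0) (m : Fin M) :
    frameOp f (e m) = lam m • e m := by
  ext i
  have h1 := h m i
  simp only [frameOp, _root_.sum_apply, ContinuousLinearMap.smulRight_apply,
    innerSL_apply_apply, EuclideanSpace.inner_single_right, PiLp.smul_apply, smul_eq_mul,
    WithLp.ofLp_sum, Finset.sum_apply, WithLp.ofLp_smul, Pi.smul_apply, conj_trivial, one_mul]
  rw [h1]
  by_cases hi : m = i
  · subst hi; simp
  · simp [hi, Ne.symm hi]

lemma hasSpectrum_of_single {M : ℕ} {S : EuclideanSpace ℝ (Fin M) →L[ℝ] EuclideanSpace ℝ (Fin M)}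
    {lam : Fin M → ℝ} (h : ∀ m, S (e m) = lam m • e m) : HasSpectrum S lam :=
  ⟨EuclideanSpace.basisFun (Fin M) ℝ, fun m => by simpa using h m⟩

lemma inner_apply_of_single {M : ℕ}
    {S : EuclideanSpace ℝ (Fin M) →L[ℝ] EuclideanSpace ℝ (Fin M)}
    {lam : Fin M → ℝ} (h : ∀ m, S (e m) = lam m • e m) (v : EuclideanSpace ℝ (Fin M)) :
    inner ℝ v (S v) = ∑ m, lam m * v m ^ 2 := by
  have hv : v = ∑ m, v m • e m := by
    ext i; simp [Pi.single_apply]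
  conv_lhs => rw [hv, map_sum, ← hv, inner_sum]
  refine sum_congr rfl fun m _ => ?_
  rw [map_smul, h, inner_smul_right, inner_smul_right, EuclideanSpace.inner_single_right]
  simp only [conj_trivial]
  ring

lemma inner_fusionFrameOp {M K : ℕ} (W : Fin K → Submodule ℝ (EuclideanSpace ℝ (Fin M)))
    (ν : Fin K → ℝ) (v : EuclideanSpace ℝ (Fin M)) :
    inner ℝ v (fusionFrameOp W ν v) = ∑ k, ν k ^ 2 * ‖(W k).starProjection v‖ ^ 2 := by
  simp only [fusionFrameOp, _root_.sum_apply, _root_.smul_apply,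
    inner_sum, inner_smul_right]
  refine sum_congr rfl fun k _ => ?_
  have := (W k).re_inner_starProjection_eq_normSq v
  rw [real_inner_comm]
  exact congrArg _ this

lemma isFusionFrame_of_single {M K : ℕ} {W : Fin K → Submodule ℝ (EuclideanSpace ℝ (Fin M))}
    {ν : Fin K → ℝ} {lam : Fin M → ℝ} {A B : ℝ} (hν : ∀ k, 0 < ν k) (hA : 0 < A) (hAB : A ≤ B)
    (hlam : ∀ m, A ≤ lam m ∧ lam m ≤ B)
    (h : ∀ m, fusionFrameOp W ν (e m) = lam m • e m) : IsFusionFrame W ν := by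
  refine ⟨hν, A, B, hA, hAB, fun v => ?_⟩
  rw [← inner_fusionFrameOp, inner_apply_of_single h, EuclideanSpace.real_norm_sq_eq,
    mul_sum, mul_sum]
  exact ⟨sum_le_sum fun m _ => mul_le_mul_of_nonneg_right (hlam m).1 (sq_nonneg _),
    sum_le_sum fun m _ => mul_le_mul_of_nonneg_right (hlam m).2 (sq_nonneg _)⟩

/-! ## The cyclic arrangement of the weights -/

/-- Each of the `d` rounds contains one copy of each weight, and a permutation preserves this count.
-/
lemma card_filter_cyc (d K : ℕ) (σ : Equiv.Perm (Fin (d * K))) (k : Fin K) :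
    #(univ.filter fun n => cyc d K (σ n) = k) = d := by
  have h : #(univ.filter fun p : Fin d × Fin K => p.2 = k) = d := by
    have : (univ.filter fun p : Fin d × Fin K => p.2 = k) = univ ×ˢ {k} := by
      ext p; simp [Prod.ext_iff, eq_comm]
    rw [this, card_product]; simp
  refine Eq.trans ?_ h
  refine card_equiv (σ.trans finProdFinEquiv.symm) fun n => ?_
  rw [mem_filter, mem_filter]
  simp [cyc]

/-- The squared norms in the cyclic arrangement, continued to all of `ℕ`. -/
noncomputable def cycSq {K : ℕ} (hK : 0 < K) (a : Fin K → ℝ) (n : ℕ) : ℝ :=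
  a ⟨n % K, Nat.mod_lt n hK⟩ ^ 2

lemma colSum_cycSq_add {K : ℕ} (hK : 0 < K) (a : Fin K → ℝ) (n : ℕ) :
    colSum (cycSq hK a) (n + K) = colSum (cycSq hK a) n + ∑ k, a k ^ 2 := by
  induction n with
  | zero =>
    rw [zero_add, colSum, colSum, sum_range_zero, zero_add, sum_range]
    refine sum_congr rfl fun k _ => ?_
    simp only [cycSq, Nat.mod_eq_of_lt k.2]
  | succ n ih =>
    rw [show n + 1 + K = n + K + 1 by ring, colSum_succ, colSum_succ, ih]
    simp only [cycSq, Nat.add_mod_right]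
    ring

lemma colSum_cycSq_mul {K : ℕ} (hK : 0 < K) (a : Fin K → ℝ) (d : ℕ) :
    colSum (cycSq hK a) (d * K) = d * ∑ k, a k ^ 2 := by
  induction d with
  | zero => simp [colSum]
  | succ d ih =>
    rw [Nat.succ_mul, colSum_cycSq_add, ih]
    push_cast
    ring

/-- Of two distinct indices, the smaller is at most the last but one. -/
lemma sq_add_sq_le {K : ℕ} {a : Fin K → ℝ} (ha : ∀ k, 0 < a k) (hm : Monotone a)
    {p q : Fin K} (hp : p.val + 2 = K) (hq : q.val + 1 = K) {i j : Fin K} (hij : i ≠ j) :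
    a i ^ 2 + a j ^ 2 ≤ a p ^ 2 + a q ^ 2 := by
  wlog h : i < j generalizing i j
  · rw [add_comm]
    exact this hij.symm (lt_of_le_of_ne (not_lt.1 h) hij.symm)
  have h1 : a i ≤ a p := hm (Fin.le_def.2 (by omega))
  have h2 : a j ≤ a q := hm (Fin.le_def.2 (by omega))
  exact add_le_add (pow_le_pow_left₀ (ha i).le h1 2) (pow_le_pow_left₀ (ha j).le h2 2)

lemma admissible_cyc {M K : ℕ} (d : ℕ) (hK : 0 < K) {a : Fin K → ℝ} (ha : ∀ k, 0 < a k)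
    (ha_mono : Monotone a) {lam : Fin M → ℝ}
    (h_trace : (d : ℝ) * ∑ k, a k ^ 2 = ∑ m, lam m)
    {p q : Fin K} (hp : p.val + 2 = K) (hq : q.val + 1 = K) {l u : Fin M}
    (hl : ∀ m, lam l ≤ lam m) (hu : ∀ m, lam m ≤ lam u)
    (h_small : a p ^ 2 + a q ^ 2 ≤ lam l) (h_large : 2 * lam u ≤ ∑ k, a k ^ 2) :
    Admissible (fun n => a (cyc d K n)) lam (cycSq hK a) K (∑ k, a k ^ 2)
      (a p ^ 2 + a q ^ 2) := by
  refine ⟨fun n => rfl, fun n => pow_pos (ha _) 2, fun n => ?_, fun i j hij => ?_,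
    fun m => h_small.trans (hl m), fun m => ?_, ?_, colSum_cycSq_add _ a, ?_⟩
  · have h1 : a ⟨n % K, Nat.mod_lt n hK⟩ ≤ a q :=
      ha_mono (Fin.le_def.2 (by have := Nat.mod_lt n hK; simp only; omega))
    have h2 := pow_le_pow_left₀ (ha _).le h1 2
    have h3 : 0 < a p ^ 2 := pow_pos (ha _) 2
    simp only [cycSq]
    linarith
  · exact sq_add_sq_le ha ha_mono hp hq fun h => hij (Fin.mk.inj h)
  · linarith [hu m]
  · linarith [hu l]
  · rw [colSum_cycSq_mul, rowSum_self, h_trace]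

end SpectralTetris

/-! ### Assembling the fusion frame -/

open SpectralTetris Finset in
theorem mainTheorem7 (M K d : ℕ) (hM : 1 ≤ M) (hK : 2 ≤ K)
    (a : Fin K → ℝ) (ha : ∀ k, 0 < a k) (ha_mono : Monotone a)
    (lam : Fin M → ℝ) (hlam_mono : Monotone lam)
    (h_trace : (d : ℝ) * ∑ k, a k ^ 2 = ∑ m, lam m)
    (h_small : a ⟨K - 2, by omega⟩ ^ 2 + a ⟨K - 1, by omega⟩ ^ 2 ≤ lam ⟨0, by omega⟩)
    (h_large : 2 * lam ⟨M - 1, by omega⟩ ≤ ∑ k, a k ^ 2) :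
    ∃ (σ : Equiv.Perm (Fin (d * K))) (f : Fin (d * K) → EuclideanSpace ℝ (Fin M))
      (J : Fin K → Finset (Fin (d * K)))
      (W : Fin K → Submodule ℝ (EuclideanSpace ℝ (Fin M))),
      SpectralTetris.Outputs (fun n => a (SpectralTetris.cyc d K n)) lam σ f ∧
      (∀ n, ‖f n‖ = a (SpectralTetris.cyc d K (σ n))) ∧
      (∀ k, J k = Finset.univ.filter fun n => SpectralTetris.cyc d K (σ n) = k) ∧
      (∀ k, W k = Submodule.span ℝ (f '' (J k : Set (Fin (d * K))))) ∧
      SpectralTetris.Generates f J W a ∧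
      (∀ k, Module.finrank ℝ (W k) = d) ∧
      SpectralTetris.HasSpectrum (SpectralTetris.fusionFrameOp W a) lam := by
  have hbound : ∀ m, lam ⟨0, by omega⟩ ≤ lam m ∧ lam m ≤ lam ⟨M - 1, by omega⟩ := fun m =>
    ⟨hlam_mono (Fin.le_def.2 (Nat.zero_le _)), hlam_mono (Fin.le_def.2 (by simp only; omega))⟩
  have H := admissible_cyc d (by omega) ha ha_mono h_trace (by simp only; omega)
    (by simp only; omega) (fun m => (hbound m).1) (fun m => (hbound m).2) h_small h_large
  obtain ⟨σ, f, hout, hnorm, hgram, horth⟩ := exists_outputs H hM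
  have hnorm' : ∀ n, ‖f n‖ = a (cyc d K (σ n)) := fun n =>
    (pow_left_inj₀ (norm_nonneg _) (ha _).le two_ne_zero).1 (hnorm n)
  set J : Fin K → Finset (Fin (d * K)) := fun k => univ.filter fun n => cyc d K (σ n) = k with hJ
  set W : Fin K → Submodule ℝ (EuclideanSpace ℝ (Fin M)) := fun k =>
    Submodule.span ℝ (f '' (J k : Set (Fin (d * K)))) with hW
  have hmem : ∀ {k n}, n ∈ J k ↔ cyc d K (σ n) = k := by simp [hJ]
  have hJn : ∀ k, ∀ n ∈ J k, ‖f n‖ = a k := fun k n hn => by rw [hnorm' n, hmem.1 hn]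
  have hJo : ∀ k, ∀ n ∈ J k, ∀ n' ∈ J k, n ≠ n' → inner ℝ (f n) (f n') = 0 :=
    fun k n hn n' hn' hne => horth n n' hne
      (congrArg Fin.val ((hmem.1 hn).trans (hmem.1 hn').symm))
  have hop : frameOp f = fusionFrameOp W a := by
    ext1 v
    simp only [frameOp, fusionFrameOp, _root_.sum_apply,
      _root_.smul_apply, ContinuousLinearMap.smulRight_apply, innerSL_apply_apply]
    -- Grouping the columns by weight turns the frame operator into a sum over the classes `J k`,
    -- each giving a multiple of a projection.
    rw [← sum_fiberwise_of_maps_to (t := univ) (g := fun n => cyc d K (σ n))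
      (fun n _ => mem_univ _)]
    exact sum_congr rfl fun k _ => (smul_starProjection_span (ha k) (hJn k) (hJo k) v).symm
  have hsingle : ∀ m, fusionFrameOp W a (e m) = lam m • e m := fun m => by
    rw [← hop]; exact frameOp_single hgram m
  refine ⟨σ, f, J, W, hout, hnorm', fun _ => rfl, fun _ => rfl, ⟨fun k l hkl => ?_, fun n => ?_,
    ?_, fun k => isTightFrameOn_span (ha k) (hJn k) (hJo k), hop⟩, fun k => ?_,
    hasSpectrum_of_single hsingle⟩
  · exact disjoint_left.2 fun n hk hl => hkl ((hmem.1 hk).symm.trans (hmem.1 hl))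
  · exact ⟨_, hmem.2 rfl⟩
  · exact isFusionFrame_of_single ha (H.lam_pos _) (hbound _).2 hbound hsingle
  · rw [hW, finrank_span_image_of_orthogonal (ha k) (hJn k) (hJo k)]
    exact card_filter_cyc d K σ k
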